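/- Let $c$ be the space of convergent real sequences with the norm $\|x\|=\sup_n|x_n|$. A Borel probability measure $\mu$ on $c$ is \emph{non-aligned} if $\mu(\{x\in c: x_j=\alpha\})=0$ for all $j\in\mathbb N$ and $\alpha\in\mathbb R$, and $\mu(\{x\in c:\lim_{j\to\infty}x_j=\alpha\})=0$ for all $\alpha\in\mathbb R$; it is \emph{fully supported} if $\mu(U)>0$ for every non-empty open set $U\subseteq c$. For a countable set $V\subseteq c$, $\delta>0$ and $p\in(0,1)$, let $\mathrm{LARG}(V,\delta,p)$ be the random graph with vertex set $V$ in which each pair of distinct points $u,v\in V$ with $\|u-v\|<\delta$ is joined by an edge independently with probability $p$, and no other pairs are joined. A countable dense set $V\subseteq c$ is \emph{Rado} if for all $\delta>0$ and $p\in(0,1)$ there is a graph $G_0$ such that, with probability $1$, $\mathrm{LARG}(V,\delta,p)$ is isomorphic to $G_0$. \textbf{Theorem.} Let $\mu$ be a non-aligned, fully supported Borel probability measure on $c$. Then for $\mu^{\mathbb N}$-almost every sequence $(x^{(i)})_{i\in\mathbb N}$ of points of $c$, the set $V=\{x^{(i)}: i\in\mathbb N\}$ is Rado (in particular, countable and dense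 in $c$). -/

import Mathlib

open scoped ENNReal
open MeasureTheory ProbabilityTheory Filter Topology

/-- The space `c` of convergent real sequences, as a subspace of `ℓ^∞`, with the supremum norm. -/
def convergentSeq : Submodule ℝ (lp (fun _ : ℕ => ℝ) ∞) where
  carrier := {x | ∃ l : ℝ, Tendsto (fun n => x n) atTop (𝓝 l)}
  zero_mem' := ⟨0, by simp⟩
  add_mem' := by
    rintro x y ⟨a, ha⟩ ⟨b, hb⟩
    exact ⟨a + b, by simpa using ha.add hb⟩
  smul_mem' := by
    rintro r x ⟨a, ha⟩
    exact ⟨r * a, by simpa using ha.const_mul r⟩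

/-- A measure on `c` is non-aligned if it vanishes on every affine coordinate hyperplane
`{x | x j = α}` and on every limit coordinate hyperplane `{x | lim x = α}`. -/
def IsNonAligned [MeasurableSpace convergentSeq] (μ : Measure convergentSeq) : Prop :=
  (∀ (j : ℕ) (α : ℝ), μ {x | x.1 j = α} = 0) ∧
    ∀ α : ℝ, μ {x | Tendsto (fun n => x.1 n) atTop (𝓝 α)} = 0

section Larg

variable {X : Type*} [NormedAddCommGroup X]

/-- The graph on `V` in which all pairs of distinct points at distance less than `δ` are joined. -/
def diskGraph (V : Set X) (δ : ℝ) : SimpleGraph V where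
  Adj u v := u ≠ v ∧ ‖(u : X) - v‖ < δ
  symm := ⟨fun u v h => ⟨h.1.symm, by rw [norm_sub_rev]; exact h.2⟩⟩
  loopless := ⟨fun _ h => h.1 rfl⟩

/-- The law of the Local Area Random Graph `LARG(V, δ, p)` with vertex set `V`: each pair of
distinct points at distance less than `δ` becomes an edge independently with probability `p`,
and no other pair is an edge. -/
noncomputable def larg (V : Set X) (δ : ℝ) (p : unitInterval) : Measure (SimpleGraph V) :=
  (setBernoulli (diskGraph V δ).edgeSet p).map SimpleGraph.fromEdgeSet

/-- The law of `LARG(V, δ, p)` is a probability measure. -/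
instance larg.isProbabilityMeasure (V : Set X) (δ : ℝ) (p : unitInterval) :
    IsProbabilityMeasure (larg V δ p) :=
  Measure.isProbabilityMeasure_map SimpleGraph.measurable_fromEdgeSet.aemeasurable

/-- A countable dense set `V` is Rado if for all `δ > 0` and `p ∈ (0, 1)` there is a single
isomorphism type of graphs to which `LARG(V, δ, p)` belongs with probability one. -/
def IsRado (V : Set X) : Prop :=
  V.Countable ∧ Dense V ∧
    ∀ (δ : ℝ) (p : unitInterval), 0 < δ → 0 < p → p < 1 →
      ∃ G₀ : SimpleGraph V, ∀ᵐ G ∂(larg V δ p), Nonempty (G ≃g G₀)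

end Larg

/-! Back-and-forth. On `c`, extended by the limit coordinate, the supremum in the norm is attained,
so `‖x - y‖ < δ` means that every coordinate difference is below `δ` in absolute value. When no
difference is a multiple of `δ`, this is read off from the floors of the differences divided by `δ`.
So one builds a graph isomorphism that preserves all these floors.

A finite partial map of this kind extends to a new point because the admissible images contain a
whole ball (`exists_ball_step`). Almost surely the random graph has in that ball a vertex with the
required adjacencies (`ae_isGeometricallyEC_larg`).

The sequence is drawn before `δ` is given, so coordinate differences equal to multiples of `δ`
cannot be excluded. But two different pairs with such differences would satisfy a rational relation,
which almost surely never occurs (`ae_coord_ne`). Hence there is at most one exceptional pair; it is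
never an edge, and the back-and-forth starts by fixing it. -/

namespace convergentSeq

/-! ### Coordinates, the attained norm and separability of `c` -/

/-- The coordinates of a convergent sequence: its entries, and its limit at `none`. -/
noncomputable def coord : Option ℕ → convergentSeq → ℝ
  | some n, x => x.1 n
  | none, x => x.2.choose

theorem tendsto_coord (x : convergentSeq) :
    Tendsto (fun n => coord (some n) x) atTop (𝓝 (coord none x)) :=
  x.2.choose_spec

theorem exists_coord_eq {f : ℕ → ℝ} {l : ℝ} (h : Tendsto f atTop (𝓝 l)) :
    ∃ x : convergentSeq, (∀ n, coord (some n) x = f n) ∧ coord none x = l := by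
  let x : convergentSeq := ⟨⟨f, memℓp_infty h.norm.bddAbove_range⟩, l, h⟩
  exact ⟨x, fun n => rfl, tendsto_nhds_unique (tendsto_coord x) h⟩

theorem abs_coord_sub_le (j : Option ℕ) (x y : convergentSeq) :
    |coord j x - coord j y| ≤ ‖x - y‖ := by
  have key : ∀ n, |coord (some n) x - coord (some n) y| ≤ ‖x - y‖ := fun n =>
    lp.norm_apply_le_norm ENNReal.top_ne_zero (x - y).1 n
  cases j with
  | some n => exact key n
  | none =>
    exact le_of_tendsto ((tendsto_coord x).sub (tendsto_coord y)).abs (.of_forall key)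

theorem norm_sub_le_of_forall_coord {x y : convergentSeq} {C : ℝ} (hC : 0 ≤ C)
    (h : ∀ n, |coord (some n) x - coord (some n) y| ≤ C) : ‖x - y‖ ≤ C :=
  lp.norm_le_of_forall_le hC h

/-- The supremum in the norm is attained, possibly by the limit coordinate. -/
theorem norm_sub_lt_iff {x y : convergentSeq} {C : ℝ} :
    ‖x - y‖ < C ↔ ∀ j, |coord j x - coord j y| < C := by
  refine ⟨fun h j => (abs_coord_sub_le j x y).trans_lt h, fun h => ?_⟩
  -- The bound at the limit controls a whole tail by `D < C`; only finitely many coordinates remain.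
  obtain ⟨D, hD, hDC⟩ := exists_between (h none)
  have ht : ∀ᶠ n in atTop, |coord (some n) x - coord (some n) y| < D :=
    ((tendsto_coord x).sub (tendsto_coord y)).abs.eventually_lt_const hD
  obtain ⟨N, hN⟩ := eventually_atTop.1 ht
  have hev : ∀ᶠ E in 𝓝[<] C, D ≤ E ∧ ∀ n ∈ Finset.range N,
      |coord (some n) x - coord (some n) y| ≤ E := by
    refine Filter.Eventually.and ?_ ((Finset.range N).eventually_all.2 fun n _ => ?_)
    · exact mem_nhdsWithin_of_mem_nhds (Ici_mem_nhds hDC)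
    · exact mem_nhdsWithin_of_mem_nhds (Ici_mem_nhds (h (some n)))
  obtain ⟨E, ⟨hDE, hE⟩, hEC⟩ := (hev.and self_mem_nhdsWithin).exists
  refine (norm_sub_le_of_forall_coord (((abs_nonneg _).trans hD.le).trans hDE) fun n => ?_).trans_lt hEC
  by_cases hn : n < N
  · exact hE n (Finset.mem_range.2 hn)
  · exact (hN n (not_lt.1 hn)).le.trans hDE

theorem continuous_coord (j : Option ℕ) : Continuous (coord j) :=
  LipschitzWith.continuous (K := 1) <| LipschitzWith.of_dist_le_mul fun x y => by
    rw [Real.dist_eq, dist_eq_norm, NNReal.coe_one, one_mul]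
    exact abs_coord_sub_le j x y

instance : Nontrivial convergentSeq := by
  obtain ⟨x, -, hx⟩ := exists_coord_eq (tendsto_const_nhds (x := (1 : ℝ)) (f := atTop (α := ℕ)))
  obtain ⟨y, -, hy⟩ := exists_coord_eq (tendsto_const_nhds (x := (0 : ℝ)) (f := atTop (α := ℕ)))
  exact ⟨x, y, fun h => by rw [h, hy] at hx; exact zero_ne_one hx⟩

/-- The eventually constant rational sequences are dense. -/
instance : TopologicalSpace.SeparableSpace convergentSeq := by
  have ht : ∀ p : (ℕ →₀ ℚ) × ℚ,
      Tendsto (fun n => ((p.1 n + p.2 : ℚ) : ℝ)) atTop (𝓝 (p.2 : ℝ)) := fun p => by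
    refine tendsto_const_nhds.congr' ?_
    obtain ⟨N, hN⟩ := p.1.support.bddAbove
    filter_upwards [eventually_gt_atTop N] with n hn
    have : p.1 n = 0 := by
      by_contra h
      exact absurd (hN (Finsupp.mem_support_iff.2 h)) (not_le.2 hn)
    simp [this]
  choose Φ hΦ _ using fun p => exists_coord_eq (ht p)
  refine ⟨Set.range Φ, Set.countable_range Φ, Metric.dense_iff.2 fun x r hr => ?_⟩
  obtain ⟨q, hq, hq'⟩ := exists_rat_btwn (show coord none x - r / 4 < coord none x + r / 4 by linarith)
  have hev : ∀ᶠ n in atTop, |coord (some n) x - q| < r / 2 := by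
    refine ((tendsto_coord x).sub_const (q : ℝ)).abs.eventually_lt_const ?_
    rw [abs_lt]; constructor <;> linarith
  obtain ⟨N, hN⟩ := eventually_atTop.1 hev
  choose g hg hg' using fun n => exists_rat_btwn
    (show coord (some n) x - r / 2 < coord (some n) x + r / 2 by linarith)
  let f : ℕ →₀ ℚ := Finsupp.onFinset (Finset.range N) (fun n => if n < N then g n - q else 0)
    fun n hn => by
      by_contra h
      exact hn (if_neg (by simpa using h))
  refine ⟨Φ (f, q), ?_, Set.mem_range_self _⟩
  rw [Metric.mem_ball, dist_eq_norm]
  refine (norm_sub_le_of_forall_coord (half_pos hr).le fun n => ?_).trans_lt (half_lt_self hr)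
  rw [hΦ]
  by_cases hn : n < N
  · simp only [f, Finsupp.onFinset_apply, if_pos hn, sub_add_cancel]
    rw [abs_le]; constructor <;> linarith [hg n, hg' n]
  · simp only [f, Finsupp.onFinset_apply, if_neg hn, zero_add]
    rw [abs_sub_comm]
    exact (hN n (not_lt.1 hn)).le

instance : SecondCountableTopology convergentSeq :=
  UniformSpace.secondCountable_of_separable _

/-! ### Extending a step pattern by one point -/

/-- Given `x` whose coordinates differ from those of the `α i` by non-multiples of `δ`, and a family
`β` with the same `δ`-step pattern as `α`, all points of some ball have the same step pattern
relative to `β` as `x` relative to `α`, and differ from `β` by non-multiples of `δ`. -/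
theorem exists_ball_step {ι : Type*} [Finite ι] {δ : ℝ} (hδ : 0 < δ) (α β : ι → convergentSeq)
    (x : convergentSeq)
    (hαβ : ∀ i k j (n : ℤ), coord j (α i) - coord j (α k) < n * δ ↔
      coord j (β i) - coord j (β k) < n * δ)
    (hx : ∀ i j (n : ℤ), coord j x - coord j (α i) ≠ n * δ) :
    ∃ z, ∃ r > 0, ∀ y ∈ Metric.ball z r, ∀ i j (n : ℤ),
      (coord j x - coord j (α i) < n * δ ↔ coord j y - coord j (β i) < n * δ) ∧
        coord j y - coord j (β i) ≠ n * δ := by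
  cases nonempty_fintype ι
  have hfloor : ∀ j i, ∃ m : ℤ, m * δ < coord j x - coord j (α i) ∧
      coord j x - coord j (α i) < (m + 1) * δ := fun j i => by
    refine ⟨⌊(coord j x - coord j (α i)) / δ⌋, lt_of_le_of_ne ?_ (hx i j _).symm, ?_⟩
    · exact (le_div_iff₀ hδ).1 (Int.floor_le _)
    · exact (div_lt_iff₀ hδ).1 (Int.lt_floor_add_one _)
  choose m hm hm' using hfloor
  -- The intervals allowed for the new coordinate overlap pairwise, as `α` and `β` have the same
  -- pattern; finitely many such open intervals on a line share a point.
  have hgap : ∀ j i k, coord j (β i) + m j i * δ < coord j (β k) + (m j k + 1) * δ := by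
    intro j i k
    have h := (hαβ i k j (m j k + 1 - m j i)).1 (by
      push_cast; linarith [hm j i, hm' j k])
    push_cast at h
    linarith
  have hmid : ∀ j, ∃ y : ℝ, ∀ i,
      coord j (β i) + m j i * δ < y ∧ y < coord j (β i) + (m j i + 1) * δ := by
    intro j
    classical
    obtain ⟨y, hy, hy'⟩ := Order.exists_between_finsets
      (Finset.univ.image fun i => coord j (β i) + m j i * δ)
      (Finset.univ.image fun i => coord j (β i) + (m j i + 1) * δ) (by
        simpa using fun i k => hgap j i k)
    exact ⟨y, fun i => ⟨hy _ (by simp), hy' _ (by simp)⟩⟩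
  choose y hy using hmid
  have heps : ∀ j, ∀ᶠ ε in 𝓝[>] (0 : ℝ), ∀ i,
      coord j (β i) + m j i * δ + ε < y j ∧ y j + ε < coord j (β i) + (m j i + 1) * δ := by
    refine fun j => eventually_all.2 fun i => ?_
    filter_upwards [mem_nhdsWithin_of_mem_nhds (Iio_mem_nhds (sub_pos.2 (hy j i).1)),
      mem_nhdsWithin_of_mem_nhds (Iio_mem_nhds (sub_pos.2 (hy j i).2))] with ε h₁ h₂
    rw [Set.mem_Iio] at h₁ h₂
    constructor <;> linarith
  -- The limit difference lies strictly between multiples of `δ`, so the floors `m (some n) i`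
  -- eventually equal `m none i`, and the constant `y none` serves the whole tail with a uniform
  -- margin. This makes `z` convergent.
  obtain ⟨ε₀, hε₀, hε₀pos⟩ := ((heps none).and self_mem_nhdsWithin).exists
  have htail : ∀ᶠ n in atTop, ∀ i,
      coord (some n) (β i) + m (some n) i * δ + ε₀ < y none ∧
        y none + ε₀ < coord (some n) (β i) + (m (some n) i + 1) * δ := by
    refine eventually_all.2 fun i => ?_
    have hlim := (tendsto_coord x).sub (tendsto_coord (α i))
    filter_upwards [hlim.eventually_const_lt (hm none i), hlim.eventually_lt_const (hm' none i),
      (tendsto_coord (β i)).eventually_lt_const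
        (show coord none (β i) < y none - ε₀ - m none i * δ by linarith [(hε₀ i).1]),
      (tendsto_coord (β i)).eventually_const_lt
        (show y none + ε₀ - (m none i + 1) * δ < coord none (β i) by linarith [(hε₀ i).2])]
      with n h₁ h₂ h₃ h₄
    have hmn : m (some n) i = m none i := by
      have h₅ := h₁.trans (hm' (some n) i)
      have h₆ := (hm (some n) i).trans h₂
      rw [mul_lt_mul_iff_of_pos_right hδ] at h₅ h₆
      norm_cast at h₅ h₆
      omega
    rw [hmn]
    constructor <;> linarith
  obtain ⟨N, hN⟩ := eventually_atTop.1 htail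
  obtain ⟨ε, ⟨hεε₀, hε⟩, hεpos⟩ := (Filter.Eventually.and
    (Filter.Eventually.and (mem_nhdsWithin_of_mem_nhds (Iic_mem_nhds hε₀pos))
      ((Finset.range N).eventually_all.2 fun n _ => heps (some n)))
    (self_mem_nhdsWithin (a := (0 : ℝ)) (s := Set.Ioi 0))).exists
  obtain ⟨z, hz, hz'⟩ := exists_coord_eq (f := fun n => if n < N then y (some n) else y none)
    (l := y none) (tendsto_const_nhds.congr' (by
      filter_upwards [eventually_ge_atTop N] with n hn
      rw [if_neg (not_lt.2 hn)]))
  have hzβ : ∀ j i, coord j (β i) + m j i * δ + ε < coord j z ∧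
      coord j z + ε < coord j (β i) + (m j i + 1) * δ := by
    rintro (_ | n) i
    · rw [hz']
      constructor <;> linarith [(hε₀ i).1, (hε₀ i).2]
    · rw [hz]
      split_ifs with hn
      · exact hε n (Finset.mem_range.2 hn) i
      · have := hN n (not_lt.1 hn) i
        constructor <;> linarith
  refine ⟨z, ε, hεpos, fun w hw i j n => ?_⟩
  have hwz := abs_lt.1 ((abs_coord_sub_le j w z).trans_lt (by rwa [← dist_eq_norm]))
  have h₁ : m j i * δ < coord j w - coord j (β i) := by linarith [(hzβ j i).1]
  have h₂ : coord j w - coord j (β i) < (m j i + 1) * δ := by linarith [(hzβ j i).2]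
  have key : ∀ t : ℝ, m j i * δ < t → t < (m j i + 1) * δ → (t < n * δ ↔ m j i < n) := by
    refine fun t ht ht' => ⟨fun h => ?_, fun h => ht'.trans_le ?_⟩
    · exact_mod_cast lt_of_mul_lt_mul_right (ht.trans h) hδ.le
    · exact mul_le_mul_of_nonneg_right (by exact_mod_cast Int.add_one_le_of_lt h) hδ.le
  refine ⟨by rw [key _ (hm j i) (hm' j i), key _ h₁ h₂], fun h => ?_⟩
  rw [h, mul_lt_mul_iff_of_pos_right hδ] at h₁ h₂
  norm_cast at h₁ h₂
  omega

end convergentSeq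

/-! ### Back-and-forth and isomorphism of geometrically existentially closed graphs -/

/-- A back-and-forth system of finite partial bijections between countable types yields a
bijection whose finite parts belong to the system. -/
theorem exists_equiv_of_back_and_forth {α β : Type*} [Countable α] [Countable β]
    (𝒮 : Set (Finset (α × β))) {P₀ : Finset (α × β)} (hP₀ : P₀ ∈ 𝒮)
    (inj : ∀ P ∈ 𝒮, ∀ p ∈ P, ∀ q ∈ P, p.1 = q.1 ↔ p.2 = q.2)
    (forth : ∀ P ∈ 𝒮, ∀ a, ∃ Q ∈ 𝒮, P ⊆ Q ∧ ∃ b, (a, b) ∈ Q)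
    (back : ∀ P ∈ 𝒮, ∀ b, ∃ Q ∈ 𝒮, P ⊆ Q ∧ ∃ a, (a, b) ∈ Q) :
    ∃ e : α ≃ β, ∀ a a', ∃ P ∈ 𝒮, (a, e a) ∈ P ∧ (a', e a') ∈ P := by
  cases nonempty_encodable α
  cases nonempty_encodable β
  -- Countably many cofinal requirements, "defined at `a`" and "hits `b`", are all met by one ideal.
  let D : α ⊕ β → Order.Cofinal 𝒮 := Sum.elim
    (fun a => ⟨{P | ∃ b, (a, b) ∈ P.1}, fun P =>
      let ⟨Q, hQ, hPQ, h⟩ := forth P.1 P.2 a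
      ⟨⟨Q, hQ⟩, h, hPQ⟩⟩)
    (fun b => ⟨{P | ∃ a, (a, b) ∈ P.1}, fun P =>
      let ⟨Q, hQ, hPQ, h⟩ := back P.1 P.2 b
      ⟨⟨Q, hQ⟩, h, hPQ⟩⟩)
  let I := Order.idealOfCofinals (⟨P₀, hP₀⟩ : 𝒮) D
  have hf : ∀ a, ∃ b, ∃ P ∈ I, (a, b) ∈ P.1 := fun a =>
    let ⟨P, ⟨b, hb⟩, hP⟩ := Order.cofinal_meets_idealOfCofinals (⟨P₀, hP₀⟩ : 𝒮) D (Sum.inl a)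
    ⟨b, P, hP, hb⟩
  have hg : ∀ b, ∃ a, ∃ P ∈ I, (a, b) ∈ P.1 := fun b =>
    let ⟨P, ⟨a, ha⟩, hP⟩ := Order.cofinal_meets_idealOfCofinals (⟨P₀, hP₀⟩ : 𝒮) D (Sum.inr b)
    ⟨a, P, hP, ha⟩
  have hI : ∀ p q, (∃ P ∈ I, p ∈ P.1) → (∃ P ∈ I, q ∈ P.1) → ∃ P ∈ 𝒮, p ∈ P ∧ q ∈ P := by
    rintro p q ⟨P, hP, hp⟩ ⟨Q, hQ, hq⟩
    obtain ⟨R, -, hPR, hQR⟩ := I.directed P hP Q hQ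
    exact ⟨R.1, R.2, hPR hp, hQR hq⟩
  choose f hf using hf
  choose g hg using hg
  refine ⟨⟨f, g, fun a => ?_, fun b => ?_⟩, fun a a' => hI _ _ (hf a) (hf a')⟩
  · obtain ⟨P, hP, h₁, h₂⟩ := hI _ _ (hf a) (hg (f a))
    exact ((inj P hP _ h₁ _ h₂).2 rfl).symm
  · obtain ⟨P, hP, h₁, h₂⟩ := hI _ _ (hf (g b)) (hg b)
    exact (inj P hP _ h₁ _ h₂).1 rfl

/-- Geometric existential closure: every finite adjacency pattern whose prescribed neighbours are
within distance `δ` of all points of an open set `U` is realised by a vertex in `U`. -/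
def IsGeometricallyEC {X : Type*} [NormedAddCommGroup X] {V : Set X} (δ : ℝ)
    (G : SimpleGraph V) : Prop :=
  ∀ U : Set X, IsOpen U → U.Nonempty → ∀ T F : Finset V, T ⊆ F →
    (∀ y ∈ U, ∀ t ∈ T, ‖y - (t : X)‖ < δ) →
      ∃ b : V, (b : X) ∈ U ∧ b ∉ F ∧ ∀ t ∈ F, G.Adj b t ↔ t ∈ T

namespace convergentSeq

variable {V : Set convergentSeq} {δ : ℝ} {G H : SimpleGraph V} {F₀ : Finset V}
  {P : Finset (V × V)}

/-- `P` is the graph of a finite partial isomorphism from `G` to `H` that preserves the `δ`-step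
pattern of all coordinates and fixes the points of `F₀`. -/
structure IsStepIso (δ : ℝ) (G H : SimpleGraph V) (F₀ : Finset V) (P : Finset (V × V)) :
    Prop where
  diag : ∀ u ∈ F₀, (u, u) ∈ P
  eq_iff : ∀ p ∈ P, ∀ q ∈ P, p.1 = q.1 ↔ p.2 = q.2
  adj_iff : ∀ p ∈ P, ∀ q ∈ P, G.Adj p.1 q.1 ↔ H.Adj p.2 q.2
  step : ∀ p ∈ P, ∀ q ∈ P, ∀ j (n : ℤ), coord j p.1.1 - coord j q.1.1 < n * δ ↔
    coord j p.2.1 - coord j q.2.1 < n * δ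

theorem IsStepIso.swap (h : IsStepIso δ G H F₀ P) :
    IsStepIso δ H G F₀ (P.map (Equiv.prodComm V V).toEmbedding) := by
  have hmem : ∀ p, p ∈ P.map (Equiv.prodComm V V).toEmbedding → p.swap ∈ P := by
    intro p hp
    obtain ⟨q, hq, rfl⟩ := Finset.mem_map.1 hp
    exact hq
  exact
    { diag := fun u hu => Finset.mem_map.2 ⟨_, h.diag u hu, rfl⟩
      eq_iff := fun p hp q hq => (h.eq_iff _ (hmem p hp) _ (hmem q hq)).symm
      adj_iff := fun p hp q hq => (h.adj_iff _ (hmem p hp) _ (hmem q hq)).symm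
      step := fun p hp q hq j n => (h.step _ (hmem p hp) _ (hmem q hq) j n).symm }

/-- Away from exact multiples of `δ`, the step pattern of a difference determines that of its
negative. -/
theorem step_neg {s t : ℝ} (hs : ∀ n : ℤ, s ≠ n * δ) (ht : ∀ n : ℤ, t ≠ n * δ)
    (h : ∀ n : ℤ, s < n * δ ↔ t < n * δ) (n : ℤ) : -s < n * δ ↔ -t < n * δ := by
  have key : ∀ r : ℝ, (∀ n : ℤ, r ≠ n * δ) → (-r < n * δ ↔ ¬ r < (-n : ℤ) * δ) := by
    intro r hr
    have := hr (-n)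
    push_cast at this ⊢
    rw [not_lt, neg_lt, ← neg_mul]
    exact ⟨le_of_lt, fun h => lt_of_le_of_ne h this.symm⟩
  rw [key s hs, key t ht, h]

/-- Neighbours of `a` are within `δ` of it, and the floors carry this over to the images for every
point of the ball, so existential closure of `H` applies there. -/
theorem IsStepIso.forth (hδ : 0 < δ) (hG : G ≤ diskGraph V δ) (hHec : IsGeometricallyEC δ H)
    (hF₀ : ∀ u v : V, u ≠ v → ¬ (u ∈ F₀ ∧ v ∈ F₀) → ∀ j (n : ℤ), coord j u.1 - coord j v.1 ≠ n * δ)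
    (h : IsStepIso δ G H F₀ P) (a : V) :
    ∃ Q, IsStepIso δ G H F₀ Q ∧ P ⊆ Q ∧ ∃ b, (a, b) ∈ Q := by
  classical
  by_cases ha : ∃ b, (a, b) ∈ P
  · exact ⟨P, h, subset_rfl, ha⟩
  have hane : ∀ p ∈ P, a ≠ p.1 := by
    rintro p hp rfl
    exact ha ⟨p.2, hp⟩
  have haF : a ∉ F₀ := fun haF => hane _ (h.diag a haF) rfl
  have hstep : ∀ p ∈ P, ∀ j (n : ℤ), coord j a.1 - coord j p.1.1 ≠ n * δ := fun p hp =>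
    hF₀ a p.1 (hane p hp) fun h => haF h.1
  obtain ⟨z, r, hr, hz⟩ := exists_ball_step hδ (fun p : P => p.1.1.1) (fun p : P => p.1.2.1) a.1
    (fun p q => h.step p.1 p.2 q.1 q.2) (fun p => hstep p.1 p.2)
  obtain ⟨b, hbU, hbF, hbadj⟩ := hHec (Metric.ball z r) Metric.isOpen_ball
    ⟨z, Metric.mem_ball_self hr⟩ ((P.filter fun p => G.Adj a p.1).image Prod.snd)
    (P.image Prod.snd) (Finset.image_subset_image (Finset.filter_subset _ _)) (by
      intro y hy t ht
      obtain ⟨p, hp, rfl⟩ := Finset.mem_image.1 ht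
      obtain ⟨hp, hap⟩ := Finset.mem_filter.1 hp
      have hnorm := (norm_sub_lt_iff.1 (hG hap).2)
      refine norm_sub_lt_iff.2 fun j => abs_lt.2 ⟨?_, ?_⟩
      · have h₁ := (step_neg (hstep p hp j) (fun n => (hz y hy ⟨p, hp⟩ j n).2)
          (fun n => (hz y hy ⟨p, hp⟩ j n).1) 1).1 (by
            push_cast; linarith [(abs_lt.1 (hnorm j)).1])
        push_cast at h₁
        linarith
      · have h₁ := (hz y hy ⟨p, hp⟩ j 1).1.1 (by
          push_cast; linarith [(abs_lt.1 (hnorm j)).2])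
        push_cast at h₁
        linarith)
  have hbne : ∀ p ∈ P, b ≠ p.2 := by
    rintro p hp rfl
    exact hbF (Finset.mem_image_of_mem _ hp)
  have hbadj' : ∀ p ∈ P, G.Adj a p.1 ↔ H.Adj b p.2 := by
    intro p hp
    rw [hbadj _ (Finset.mem_image_of_mem _ hp), Finset.mem_image]
    refine ⟨fun h => ⟨p, Finset.mem_filter.2 ⟨hp, h⟩, rfl⟩, ?_⟩
    rintro ⟨q, hq, hqp⟩
    obtain ⟨hq, haq⟩ := Finset.mem_filter.1 hq
    rwa [← (h.eq_iff q hq p hp).2 hqp]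
  refine ⟨insert (a, b) P, ?_, Finset.subset_insert _ _, b, Finset.mem_insert_self _ _⟩
  constructor
  · exact fun u hu => Finset.mem_insert_of_mem (h.diag u hu)
  · simp only [Finset.forall_mem_insert, true_and]
    exact ⟨fun p hp => iff_of_false (hane p hp) (hbne p hp), fun p hp =>
      ⟨iff_of_false (hane p hp).symm (hbne p hp).symm, h.eq_iff p hp⟩⟩
  · simp only [Finset.forall_mem_insert, SimpleGraph.irrefl, true_and]
    exact ⟨hbadj', fun p hp =>
      ⟨by rw [G.adj_comm, H.adj_comm]; exact hbadj' p hp, h.adj_iff p hp⟩⟩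
  · simp only [Finset.forall_mem_insert, sub_self, implies_true, true_and]
    refine ⟨fun p hp j n => (hz b hbU ⟨p, hp⟩ j n).1, fun p hp => ⟨fun j n => ?_, h.step p hp⟩⟩
    rw [← neg_sub, ← neg_sub (coord j b.1)]
    exact step_neg (hstep p hp j) (fun n => (hz b hbU ⟨p, hp⟩ j n).2)
      (fun n => (hz b hbU ⟨p, hp⟩ j n).1) n

/-- Two geometrically existentially closed graphs of threshold `δ` are isomorphic, provided that
the pairs of points some coordinates of which differ by a multiple of `δ` lie in a finite set of
points that are pairwise at distance at least `δ`. -/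
theorem nonempty_iso_of_isGeometricallyEC [Countable V] (hδ : 0 < δ)
    (hG : G ≤ diskGraph V δ) (hH : H ≤ diskGraph V δ)
    (hGec : IsGeometricallyEC δ G) (hHec : IsGeometricallyEC δ H)
    (hF₀ : ∀ u v : V, u ≠ v → ¬ (u ∈ F₀ ∧ v ∈ F₀) → ∀ j (n : ℤ), coord j u.1 - coord j v.1 ≠ n * δ)
    (hF₀δ : ∀ u ∈ F₀, ∀ v ∈ F₀, ¬ (diskGraph V δ).Adj u v) : Nonempty (G ≃g H) := by
  classical
  have hbase : IsStepIso δ G H F₀ (F₀.image fun u => (u, u)) := by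
    constructor
    · exact fun u hu => Finset.mem_image_of_mem _ hu
    · simp only [Finset.forall_mem_image, implies_true]
    · simp only [Finset.forall_mem_image]
      exact fun u hu v hv => iff_of_false (fun h => hF₀δ u hu v hv (hG h))
        fun h => hF₀δ u hu v hv (hH h)
    · simp only [Finset.forall_mem_image, implies_true]
  have hback : ∀ P, IsStepIso δ G H F₀ P → ∀ b, ∃ Q, IsStepIso δ G H F₀ Q ∧ P ⊆ Q ∧
      ∃ a, (a, b) ∈ Q := by
    intro P hP b
    obtain ⟨Q, hQ, hPQ, a, ha⟩ := IsStepIso.forth hδ hH hGec hF₀ hP.swap b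
    refine ⟨_, hQ.swap, fun p hp => ?_, a, Finset.mem_map.2 ⟨_, ha, rfl⟩⟩
    exact Finset.mem_map.2 ⟨p.swap, hPQ (Finset.mem_map.2 ⟨p, hp, rfl⟩), rfl⟩
  obtain ⟨e, he⟩ := exists_equiv_of_back_and_forth {P | IsStepIso δ G H F₀ P} hbase
    (fun P hP => hP.eq_iff) (fun P hP a => IsStepIso.forth hδ hG hHec hF₀ hP a) hback
  refine ⟨⟨e, fun {a b} => ?_⟩⟩
  obtain ⟨P, hP, ha, hb⟩ := he a b
  exact (hP.adj_iff _ ha _ hb).symm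

end convergentSeq

/-! ### Almost sure density and existential closure -/

/-- If infinitely many pairwise disjoint finite blocks of coordinates each satisfy a prescribed box
condition with probability bounded below, then almost surely some block satisfies it. -/
theorem ae_exists_block_infinitePi {ι : Type*} {X : ι → Type*} [∀ i, MeasurableSpace (X i)]
    (μ : ∀ i, Measure (X i)) [∀ i, IsProbabilityMeasure (μ i)] {A : ℕ → Finset ι}
    (hA : Pairwise (Function.onFun Disjoint A)) {t : ∀ i, Set (X i)} (ht : ∀ i, MeasurableSet (t i))
    {ε : ℝ≥0∞} (hε : ε ≠ 0) (h : ∀ k, ε ≤ ∏ i ∈ A k, μ i (t i)) :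
    ∀ᵐ x ∂Measure.infinitePi μ, ∃ k, ∀ i ∈ A k, x i ∈ t i := by
  classical
  let s : ℕ → Set (∀ i, X i) := fun k => Set.pi (A k) t
  have hs : ∀ k, MeasurableSet (s k) := fun k =>
    MeasurableSet.pi (A k).countable_toSet fun i _ => ht i
  have hμs : ∀ k, Measure.infinitePi μ (s k) = ∏ i ∈ A k, μ i (t i) := fun k =>
    Measure.infinitePi_pi _ fun i _ => ht i
  have hind : iIndepSet s (Measure.infinitePi μ) := by
    rw [iIndepSet_iff_meas_biInter hs]
    intro S
    have : ⋂ k ∈ S, s k = Set.pi (S.biUnion A : Finset ι) t := by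
      ext x
      simp only [s, Set.mem_iInter, Set.mem_pi, SetLike.mem_coe, Finset.mem_biUnion]
      exact ⟨fun h i ⟨k, hk, hi⟩ => h k hk i hi, fun h k hk i hi => h i ⟨k, hk, hi⟩⟩
    rw [this, Measure.infinitePi_pi _ fun i _ => ht i,
      Finset.prod_biUnion fun i _ j _ hij => hA hij]
    exact (Finset.prod_congr rfl fun k _ => hμs k).symm
  have hsum : ∑' k, Measure.infinitePi μ (s k) = ∞ :=
    top_unique ((ENNReal.tsum_const_eq_top_of_ne_zero hε).ge.trans
      (ENNReal.tsum_le_tsum fun k => (h k).trans (hμs k).ge))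
  have hlim := measure_limsup_eq_one hs hind hsum
  have hmeas : MeasurableSet (limsup s atTop) := MeasurableSet.measurableSet_limsup hs
  filter_upwards [(prob_compl_eq_zero_iff hmeas).2 hlim |> compl_mem_ae_iff.2] with x hx
  rw [compl_compl, mem_limsup_iff_frequently_mem] at hx
  exact hx.exists

/-- An i.i.d. sequence with fully supported law is almost surely dense. -/
theorem ae_dense_range_infinitePi {X : Type*} [TopologicalSpace X] [SecondCountableTopology X]
    [MeasurableSpace X] [OpensMeasurableSpace X] (μ : Measure X) [IsProbabilityMeasure μ]
    [μ.IsOpenPosMeasure] :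
    ∀ᵐ x ∂Measure.infinitePi fun _ : ℕ => μ, Dense (Set.range x) := by
  have h : ∀ U ∈ TopologicalSpace.countableBasis X, ∀ᵐ x ∂Measure.infinitePi fun _ : ℕ => μ,
      ∃ k, x k ∈ U := by
    intro U hU
    have hUo := TopologicalSpace.isOpen_of_mem_countableBasis hU
    have := ae_exists_block_infinitePi (fun _ : ℕ => μ) (A := fun k => {k}) (t := fun _ => U)
      (fun i j hij => by simpa [Function.onFun] using hij) (fun _ => hUo.measurableSet)
      (hUo.measure_ne_zero μ (TopologicalSpace.nonempty_of_mem_countableBasis hU)) (fun k => by simp)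
    simpa using this
  have h' := (ae_ball_iff (TopologicalSpace.countable_countableBasis X)).2 h
  filter_upwards [h'] with x hx
  refine (TopologicalSpace.isBasis_countableBasis X).dense_iff.2 fun U hU _ => ?_
  obtain ⟨k, hk⟩ := hx U hU
  exact ⟨x k, hk, k, rfl⟩

section Larg

variable {X : Type*} [NormedAddCommGroup X] {V : Set X} {δ : ℝ} {p : unitInterval}

theorem measurable_adj_apply {W : Type*} (u v : W) :
    Measurable fun G : SimpleGraph W => G.Adj u v :=
  SimpleGraph.measurable_iff_adj.1 measurable_id u v

theorem ae_larg_le_diskGraph [Countable V] : ∀ᵐ G ∂larg V δ p, G ≤ diskGraph V δ := by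
  have hmeas : MeasurableSet {G : SimpleGraph V | G ≤ diskGraph V δ} := by
    simp only [SimpleGraph.le_iff_adj]
    exact measurableSet_setOfPred.2 (.forall fun u => .forall fun v =>
      (measurable_adj_apply u v).imp measurable_const)
  rw [larg, ae_map_iff SimpleGraph.measurable_fromEdgeSet.aemeasurable hmeas]
  filter_upwards [setBernoulli_ae_subset] with s hs u v huv
  exact hs huv.1

/-- Distinct candidates `b` outside `F` use disjoint sets of edges to `F`, and each succeeds with
probability at least `min p (1 - p) ^ F.card`. -/
theorem ae_larg_exists_vertex [Countable V] (hp : 0 < p) (hp' : p < 1) {B : Set V}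
    (hB : B.Infinite) {T F : Finset V} (hTF : T ⊆ F)
    (hT : ∀ b ∈ B, ∀ t ∈ T, ‖(b : X) - t‖ < δ) :
    ∀ᵐ G ∂larg V δ p, ∃ b ∈ B, b ∉ F ∧ ∀ t ∈ F, G.Adj b t ↔ t ∈ T := by
  classical
  have hBF : (B \ F).Infinite := hB.sdiff F.finite_toSet
  let b : ℕ → V := fun k => hBF.natEmbedding _ k
  have hbB : ∀ k, b k ∈ B := fun k => (hBF.natEmbedding _ k).2.1
  have hbF : ∀ k, b k ∉ F := fun k => (hBF.natEmbedding _ k).2.2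
  have hbinj : Function.Injective b := Subtype.val_injective.comp (hBF.natEmbedding _).injective
  -- The block lemma needs a target depending on the unordered pair alone; since `b k ∉ T`, "the
  -- pair meets `T`" encodes `t ∈ T`.
  have hmemT : ∀ k t, (∃ t' ∈ T, t' ∈ s(b k, t)) ↔ t ∈ T := by
    refine fun k t => ⟨?_, fun ht => ⟨t, ht, Sym2.mem_mk_right _ _⟩⟩
    rintro ⟨t', ht', h⟩
    rcases Sym2.mem_iff.1 h with rfl | rfl
    · exact absurd (hTF ht') (hbF k)
    · exact ht'
  have hmeas : MeasurableSet {G : SimpleGraph V | ∃ b ∈ B, b ∉ F ∧ ∀ t ∈ F, G.Adj b t ↔ t ∈ T} :=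
    measurableSet_setOfPred.2 (.exists fun b => measurable_const.and <| measurable_const.and <|
      .forall fun t => measurable_const.imp <| (measurable_adj_apply b t).iff measurable_const)
  rw [larg, ae_map_iff SimpleGraph.measurable_fromEdgeSet.aemeasurable hmeas, setBernoulli_eq_map]
  refine (ae_map_iff (f := fun q : Sym2 V → Prop => {e | q e})
    MeasurableEquiv.setOfPred.measurable.aemeasurable
    (SimpleGraph.measurable_fromEdgeSet hmeas)).2 ?_
  have key := ae_exists_block_infinitePi (fun e : Sym2 V =>
    unitInterval.toNNReal p • Measure.dirac (e ∈ (diskGraph V δ).edgeSet) +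
      unitInterval.toNNReal (unitInterval.symm p) • Measure.dirac False)
    (A := fun k => F.image fun t => s(b k, t)) ?_ (t := fun e => {P | P ↔ ∃ t ∈ T, t ∈ e})
    (fun e => measurableSet_setOfPred.2 (measurable_id.iff measurable_const))
    (ε := (min (unitInterval.toNNReal p : ℝ≥0∞)
      (unitInterval.toNNReal (unitInterval.symm p))) ^ F.card) ?_ ?_
  · filter_upwards [key] with s ⟨k, hk⟩
    refine ⟨b k, hbB k, hbF k, fun t ht => ?_⟩
    have hbt : b k ≠ t := fun h => hbF k (h ▸ ht)
    have : s s(b k, t) ↔ _ := hk _ (Finset.mem_image_of_mem _ ht)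
    rw [SimpleGraph.fromEdgeSet_adj]
    rw [hmemT k t] at this
    exact (and_iff_left hbt).trans this
  · intro i j hij
    refine Finset.disjoint_left.2 fun e hi hj => ?_
    obtain ⟨t, ht, rfl⟩ := Finset.mem_image.1 hi
    obtain ⟨t', ht', h⟩ := Finset.mem_image.1 hj
    rcases Sym2.eq_iff.1 h with ⟨h, -⟩ | ⟨h, -⟩
    · exact hij (hbinj h.symm)
    · exact hbF j (h ▸ ht)
  · refine pow_ne_zero _ (lt_min ?_ ?_).ne'
    · exact ENNReal.coe_pos.2 hp
    · exact ENNReal.coe_pos.2 (show (0 : ℝ) < 1 - p from sub_pos.2 hp')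
  · intro k
    have hinj : Function.Injective fun t => s(b k, t) := fun t t' h => Sym2.congr_right.1 h
    rw [Finset.prod_image hinj.injOn]
    refine Finset.pow_card_le_prod _ _ _ fun t ht => ?_
    by_cases htT : t ∈ T
    · have hadj : s(b k, t) ∈ (diskGraph V δ).edgeSet :=
        ⟨fun h : b k = t => hbF k (h ▸ ht), hT _ (hbB k) t htT⟩
      have : {P : Prop | P ↔ ∃ t' ∈ T, t' ∈ s(b k, t)} = {P | P} := by
        ext P; rw [Set.mem_ofPred_eq, hmemT]; simp [htT]
      rw [this]
      simp [hadj]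
    · have : {P : Prop | P ↔ ∃ t' ∈ T, t' ∈ s(b k, t)} = {P | ¬ P} := by
        ext P; rw [Set.mem_ofPred_eq, hmemT]; simp [htT]
      rw [this]
      simp

/-- A countable basis leaves countably many conditions; without isolated points, a dense set meets
each basic open set infinitely often. -/
theorem ae_isGeometricallyEC_larg [SecondCountableTopology X] [∀ x : X, NeBot (𝓝[≠] x)]
    (hV : V.Countable) (hVd : Dense V) (hp : 0 < p) (hp' : p < 1) :
    ∀ᵐ G ∂larg V δ p, IsGeometricallyEC δ G := by
  have := hV.to_subtype
  have hU : ∀ U ∈ TopologicalSpace.countableBasis X, ∀ T F : Finset V, T ⊆ F →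
      (∀ y ∈ U, ∀ t ∈ T, ‖y - (t : X)‖ < δ) → ∀ᵐ G ∂larg V δ p,
        ∃ b : V, (b : X) ∈ U ∧ b ∉ F ∧ ∀ t ∈ F, G.Adj b t ↔ t ∈ T := by
    intro U hU T F hTF hT
    have hUo := TopologicalSpace.isOpen_of_mem_countableBasis hU
    refine ae_larg_exists_vertex hp hp' (B := {b : V | (b : X) ∈ U}) (fun hfin => ?_) hTF
      fun b hb t ht => hT b hb t ht
    obtain ⟨y, hyU, hyV, hy⟩ := (hVd.sdiff_finite (hfin.image Subtype.val)).inter_open_nonempty U hUo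
      (TopologicalSpace.nonempty_of_mem_countableBasis hU)
    exact hy ⟨⟨y, hyV⟩, hyU, rfl⟩
  have hall := (ae_ball_iff (TopologicalSpace.countable_countableBasis X)).2 fun U h =>
    ae_all_iff.2 fun T => ae_all_iff.2 fun F => eventually_imp_distrib_left.2 fun hTF =>
      eventually_imp_distrib_left.2 fun hT => hU U h T F hTF hT
  filter_upwards [hall] with G hG U hUo hUne T F hTF hT
  obtain ⟨x, hx⟩ := hUne
  obtain ⟨U', hU', -, hU'U⟩ :=
    (TopologicalSpace.isBasis_countableBasis X).exists_subset_of_mem_open hx hUo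
  obtain ⟨b, hb, h⟩ := hG U' hU' T F hTF fun y hy => hT y (hU'U hy)
  exact ⟨b, hU'U hb, h⟩

end Larg

/-! ### General position of the sample -/

/-- For an i.i.d. family, an atomless function of one member almost surely avoids any measurable
function of finitely many other members. -/
theorem ae_infinitePi_ne {ι E : Type*} [MeasurableSpace E] (μ : Measure E) [IsProbabilityMeasure μ]
    {φ : E → ℝ} (hφ : Measurable φ) (hφμ : ∀ α, μ {x | φ x = α} = 0) {S : Finset ι} {l : ι}
    (hl : l ∉ S) {g : (S → E) → ℝ} (hg : Measurable g) :
    ∀ᵐ x ∂Measure.infinitePi fun _ : ι => μ, φ (x l) ≠ g fun i => x i := by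
  have hind : iIndepFun (fun i (x : ι → E) => x i) (Measure.infinitePi fun _ : ι => μ) :=
    iIndepFun_infinitePi (X := fun _ x => x) fun _ => measurable_id
  have hpair : IndepFun (fun x (i : S) => x i) (fun x : ι → E => x l)
      (Measure.infinitePi fun _ : ι => μ) :=
    (hind.indepFun_finset S {l} (Finset.disjoint_singleton_right.2 hl)
      fun i => measurable_pi_apply i).comp measurable_id
        (measurable_pi_apply (⟨l, Finset.mem_singleton_self l⟩ : ({l} : Finset ι)))
  have hS : Measurable fun (x : ι → E) (i : S) => x i := by fun_prop
  have hmap := (indepFun_iff_map_prod_eq_prod_map_map hS.aemeasurable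
    (measurable_pi_apply l).aemeasurable).1 hpair
  rw [Measure.infinitePi_map_eval (fun _ : ι => μ) l] at hmap
  have hmeas : MeasurableSet {q : (S → E) × E | φ q.2 = g q.1} :=
    measurableSet_eq_fun (hφ.comp measurable_snd) (hg.comp measurable_fst)
  have hnull : (Measure.infinitePi fun _ : ι => μ).map (fun x => ((fun i : S => x i), x l))
      {q : (S → E) × E | φ q.2 = g q.1} = 0 := by
    have := Measure.isProbabilityMeasure_map (μ := Measure.infinitePi fun _ : ι => μ) hS.aemeasurable
    rw [hmap, Measure.measure_prod_null hmeas]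
    exact .of_forall fun s => hφμ (g s)
  rw [Measure.map_apply (hS.prodMk (measurable_pi_apply l)) hmeas] at hnull
  exact measure_eq_zero_iff_ae_notMem.1 hnull

namespace convergentSeq

theorem measure_coord_eq_zero [MeasurableSpace convergentSeq] {μ : Measure convergentSeq}
    (hμ : IsNonAligned μ) (j : Option ℕ) (α : ℝ) : μ {x | coord j x = α} = 0 := by
  cases j with
  | some n => exact hμ.1 n α
  | none =>
    refine measure_mono_null (fun x hx => ?_) (hμ.2 α)
    rw [Set.mem_ofPred_eq] at hx ⊢
    exact hx ▸ tendsto_coord x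

/-- Rational `c` keeps the conditions countable and covers every `δ` at once: a ratio of two
multiples of `δ` is rational. -/
theorem ae_coord_ne [MeasurableSpace convergentSeq] [BorelSpace convergentSeq]
    {μ : Measure convergentSeq} [IsProbabilityMeasure μ] (hμ : IsNonAligned μ) :
    ∀ᵐ x ∂Measure.infinitePi fun _ : ℕ => μ, ∀ (j j' : Option ℕ) (c : ℚ) (l l' i i' : ℕ),
      l ≠ l' → l ≠ i → l ≠ i' →
        coord j (x l) ≠ coord j (x l') + c * (coord j' (x i) - coord j' (x i')) := by
  simp only [ae_all_iff, eventually_imp_distrib_left]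
  intro j j' c l l' i i' hl' hi hi'
  have hm : ∀ k (a : ({l', i, i'} : Finset ℕ)),
      Measurable fun s : ({l', i, i'} : Finset ℕ) → convergentSeq => coord k (s a) := fun k a =>
    (continuous_coord k).measurable.comp (measurable_pi_apply a)
  exact ae_infinitePi_ne μ (continuous_coord j).measurable (measure_coord_eq_zero hμ j)
    (S := {l', i, i'}) (by simp [hl', hi, hi'])
    (g := fun s => coord j (s ⟨l', by simp⟩) +
      c * (coord j' (s ⟨i, by simp⟩) - coord j' (s ⟨i', by simp⟩)))
    ((hm _ _).add (((hm _ _).sub (hm _ _)).const_mul _))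

/-- For a sequence in general position, all pairs of points some coordinates of which differ by a
multiple of `δ` coincide, and the points of such a pair are at distance at least `δ`. -/
theorem exists_finset_aligned {x : ℕ → convergentSeq}
    (hx : ∀ (j j' : Option ℕ) (c : ℚ) (l l' i i' : ℕ), l ≠ l' → l ≠ i → l ≠ i' →
      coord j (x l) ≠ coord j (x l') + c * (coord j' (x i) - coord j' (x i')))
    {δ : ℝ} (hδ : 0 < δ) :
    ∃ F₀ : Finset (Set.range x),
      (∀ u v, u ≠ v → ¬ (u ∈ F₀ ∧ v ∈ F₀) → ∀ j (n : ℤ), coord j u.1 - coord j v.1 ≠ n * δ) ∧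
      ∀ u ∈ F₀, ∀ v ∈ F₀, ¬ (diskGraph (Set.range x) δ).Adj u v := by
  classical
  by_cases h : ∃ u v : Set.range x, u ≠ v ∧ ∃ j, ∃ n : ℤ, coord j u.1 - coord j v.1 = n * δ
  swap
  · push Not at h
    exact ⟨∅, fun u v huv _ => h u v huv, by simp⟩
  obtain ⟨⟨_, i, rfl⟩, ⟨_, i', rfl⟩, huv, j, n, hn⟩ := h
  have hii' : i ≠ i' := fun h => huv (by simp [h])
  have hcoord : coord j (x i) ≠ coord j (x i') := by
    -- With `c = 0`, no two points share a coordinate.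
    simpa using hx j j 0 i i' i' i' hii' hii' hii'
  have hn0 : n ≠ 0 := by
    rintro rfl
    exact hcoord (sub_eq_zero.1 (by simpa using hn))
  have hδn : δ = (coord j (x i) - coord j (x i')) / n := by
    rw [hn]
    field_simp
  have key : ∀ l l', l ≠ l' → l ≠ i → l ≠ i' → ∀ k (m : ℤ),
      coord k (x l) - coord k (x l') ≠ m * δ := by
    intro l l' hl' hi hi' k m hm
    refine hx k j (m / n) l l' i i' hl' hi hi' ?_
    rw [sub_eq_iff_eq_add'.1 hm, hδn]
    push_cast
    ring
  have hadj : ¬ (diskGraph (Set.range x) δ).Adj ⟨x i, i, rfl⟩ ⟨x i', i', rfl⟩ := by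
    intro h
    have := norm_sub_lt_iff.1 h.2 j
    rw [hn, abs_mul, abs_of_pos hδ, mul_lt_iff_lt_one_left hδ] at this
    exact hn0 (Int.abs_lt_one_iff.1 (by exact_mod_cast this))
  refine ⟨{⟨x i, i, rfl⟩, ⟨x i', i', rfl⟩}, ?_, ?_⟩
  · rintro ⟨_, l, rfl⟩ ⟨_, l', rfl⟩ hne hmem k m hm
    have hll' : l ≠ l' := fun h => hne (by simp [h])
    -- One of `l`, `l'` lies outside the exceptional pair and plays the independent index in `key`.
    by_cases hl : l = i ∨ l = i'
    · refine key l' l hll'.symm ?_ ?_ k (-m) (by push_cast; linarith)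
      · rintro rfl
        rcases hl with rfl | rfl
        · exact hll' rfl
        · exact hmem (by simp)
      · rintro rfl
        rcases hl with rfl | rfl
        · exact hmem (by simp)
        · exact hll' rfl
    · rw [not_or] at hl
      exact key l l' hll' hl.1 hl.2 k m hm
  · simp only [Finset.forall_mem_insert, Finset.mem_singleton, forall_eq]
    exact ⟨⟨SimpleGraph.irrefl _, hadj⟩, fun h => hadj h.symm, SimpleGraph.irrefl _⟩

end convergentSeq

theorem theorem1 [MeasurableSpace convergentSeq] [BorelSpace convergentSeq]
    (μ : Measure convergentSeq) [IsProbabilityMeasure μ] [μ.IsOpenPosMeasure]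
    (hμ : IsNonAligned μ) :
    ∀ᵐ x ∂(Measure.infinitePi fun _ : ℕ => μ), IsRado (Set.range x) := by
  have hnb : ∀ y : convergentSeq, NeBot (𝓝[≠] y) := Module.punctured_nhds_neBot ℝ convergentSeq
  filter_upwards [ae_dense_range_infinitePi μ, convergentSeq.ae_coord_ne hμ] with x hdense hx
  have hcount : Countable (Set.range x) := (Set.countable_range x).to_subtype
  refine ⟨Set.countable_range x, hdense, fun δ p hδ hp hp' => ?_⟩
  have hG : ∀ᵐ G ∂larg (Set.range x) δ p, G ≤ diskGraph _ δ ∧ IsGeometricallyEC δ G :=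
    ae_larg_le_diskGraph.and (ae_isGeometricallyEC_larg (Set.countable_range x) hdense hp hp')
  obtain ⟨F₀, hF₀, hF₀δ⟩ := convergentSeq.exists_finset_aligned hx hδ
  -- Any single good sample serves as the isomorphism type.
  obtain ⟨G₀, hG₀⟩ := hG.exists
  refine ⟨G₀, ?_⟩
  filter_upwards [hG] with G hG
  exact convergentSeq.nonempty_iso_of_isGeometricallyEC hδ hG.1 hG₀.1 hG.2 hG₀.2 hF₀ hF₀δ
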